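/- Let $\mu$ be a $\sigma$-finite Borel measure on $\mathbb R$ without atoms, and let $U\subset\mathbb R$ be a non-empty Borel set with $\mu(\mathbb R\setminus U)=0$. Denote by $\partial U$ and $\operatorname{clos} U$ the boundary and the closure of $U$ in $\mathbb R$, regarded as subsets of $\mathbb C$. Let $H$ be a reproducing kernel subspace in $L^2(\mathbb R,\mu)$, that is, a complex linear set of Borel functions $f:U\to\mathbb C$ with $\int |f|^2\,d\mu<\infty$ which is closed in the $L^2(\mathbb R,\mu)$ norm and for which, for every $k\in U$, the functional $f\mapsto f(k)$ is bounded on $H$ in the $L^2(\mathbb R,\mu)$ norm. For a function $g$ on $U$ and $p\in\mathbb C$ we write $\frac{g(x)}{x-p}\in H$ if there is a $q\in H$ with $q(x)(x-p)=g(x)$ for all $x\in U\setminus\{p\}$. Assume that $H$ has the strong division property: for all $f\in H$ and $k\in U$, $$\frac{f(x)-f(k)}{x-k}\in H .$$ Let $\mathcal N=\left\{z\in\mathbb C\setminus\partial U:\ \frac1{x-z}\in H\right\}$. Then: 1. $\mathcal N\subset\mathbb C\setminus\operatorname{clos}U$; 2. $\mathcal N$ is discrete in $\mathbb C\setminus\partial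 U$, that is, it has no accumulation point in $\mathbb C\setminus\partial U$; 3. every $f\in H$ extends to a meromorphic function on $\mathbb C\setminus\partial U$ with all poles in $\mathcal N$; that is, there is a function $F$ which is meromorphic on $\mathbb C\setminus\partial U$, holomorphic at every point of $(\mathbb C\setminus\partial U)\setminus\mathcal N$, defined and holomorphic in a complex neighbourhood of every point of $U$ (including the points of $U\cap\partial U$), and satisfies $F(x)=f(x)$ for all $x\in U$. -/

import Mathlib

open MeasureTheory Filter Topology
open scoped ENNReal NNReal

namespace DivisionSubspace

/-- A complex linear set `H` of Borel functions on `U`, square integrable with respect to `μ`, is a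
reproducing kernel subspace of `L²(ℝ, μ)` if it is closed in the `L²` norm and all evaluations at
points of `U` are bounded in the `L²` norm.  The measure on `U` is the one induced by `μ`. -/
structure IsReproducingKernelSubspace (μ : Measure ℝ) (U : Set ℝ) (H : Submodule ℂ (U → ℂ)) :
    Prop where
  measurable : ∀ f ∈ H, Measurable f
  memLp : ∀ f ∈ H, MemLp f 2 (μ.comap ((↑) : U → ℝ))
  isClosed : IsClosed {h : Lp ℂ 2 (μ.comap ((↑) : U → ℝ)) |
    ∃ f ∈ H, (h : U → ℂ) =ᵐ[μ.comap ((↑) : U → ℝ)] f}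
  bounded_eval : ∀ k : U, ∃ C : ℝ≥0, ∀ f ∈ H,
    ‖f k‖ₑ ≤ C * eLpNorm f 2 (μ.comap ((↑) : U → ℝ))

/-- The quotient `g / (x - p)` belongs to `H`: some element `q` of `H` satisfies
`q x * (x - p) = g x` at all points `x` of `U` at which the quotient makes sense, that is `x ≠ p`.
(If `g p = 0`, the equation holds at `x = p` too.) -/
def QuotientMem {U : Set ℝ} (H : Submodule ℂ (U → ℂ)) (g : U → ℂ) (p : ℂ) : Prop :=
  ∃ q ∈ H, ∀ x : U, ((x : ℝ) : ℂ) ≠ p → q x * (((x : ℝ) : ℂ) - p) = g x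

/-- Strong division property: `(f - f k) / (x - k) ∈ H` for all `f ∈ H` and `k ∈ U`. -/
def StrongDivision {U : Set ℝ} (H : Submodule ℂ (U → ℂ)) : Prop :=
  ∀ k : U, ∀ f ∈ H, QuotientMem H (fun x => f x - f k) ((k : ℝ) : ℂ)

/-- The boundary `∂U` of `U` relative to the real line, as a subset of `ℂ`. -/
def realBoundary (U : Set ℝ) : Set ℂ := Complex.ofReal '' frontier U

/-- The set of all `z ∈ ℂ \ ∂U` such that `1 / (x - z) ∈ H`. -/
def poleSet {U : Set ℝ} (H : Submodule ℂ (U → ℂ)) : Set ℂ :=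
  {z | z ∉ realBoundary U ∧ QuotientMem H (fun _ => 1) z}

/-- `F` is a meromorphic extension of `f : U → ℂ` to `ℂ \ ∂U` with all poles in `N`: it is
meromorphic on `ℂ \ ∂U` and holomorphic there off `N`; and it extends `f`, that is, it is
holomorphic at every point of `U` (also at those on the boundary of `U`) and equals `f` on `U`. -/
structure IsMeromorphicExtension {U : Set ℝ} (f : U → ℂ) (N : Set ℂ) (F : ℂ → ℂ) : Prop where
  meromorphicOn : MeromorphicOn F (realBoundary U)ᶜ
  analyticAt_off : ∀ z, z ∉ realBoundary U → z ∉ N → AnalyticAt ℂ F z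
  analyticAt : ∀ x : U, AnalyticAt ℂ F ((x : ℝ) : ℂ)
  eq_on : ∀ x : U, F ((x : ℝ) : ℂ) = f x

end DivisionSubspace

/-! Fix l ∈ U at which some element of H does not vanish. Let e be evaluation at l and D f = (f -
f(l))/(x - l), which is bounded by the closed graph theorem. From (x - l)(1 - (z - l)D)f = (x - z)f
+ (z - l)f(l), the kernel of the pencil 1 - (z - l)D at z ∉ U consists of the multiples of 1/(x - z)
that lie in H. At k ∈ U strong division inverts the pencil by f ↦ f + (k - l)(f - f(k))/(x - k),
whose value at l is f(k). Hence F(z) = e((1 - (z - l)D)⁻¹ f) extends f and is holomorphic wherever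
the pencil is invertible.

It remains to show that off clos U the pencil fails to be invertible only through its kernel, and
only at isolated points. There (x - l)/(x - z) is bounded; its compression B(z) to H satisfies
B(z)(1 - (z - l)D) = 1 + (z - l)e(·)β(z), where β(z) is the projection of 1/(x - z). Cramer's rule
for this rank-one perturbation, with determinant a = 1 + (z - l)e(β), gives F = e(B f)/a.

Three facts carry the argument: the adjugate is also a right inverse up to a
(`pencil_adjugateParametrix`); a vanishes identically on neither half-plane
(`rankOneDet_compression_ne_zero`); at a zero of a, an injective pencil is still surjective
(`isUnit_pencil_of_injective`). -/

namespace DivisionSubspace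

/-! ### Identity principle across the two half-planes -/

section IdentityPrinciple

variable {E : Type*} [NormedAddCommGroup E] [NormedSpace ℂ E]

theorem isOpen_compl_ofReal_image {S : Set ℝ} (hS : IsClosed S) :
    IsOpen ((Complex.ofReal '' S)ᶜ) :=
  (Complex.isometry_ofReal.isClosedEmbedding.isClosedMap _ hS).isOpen_compl

theorem mem_compl_ofReal_image_of_im_ne_zero (S : Set ℝ) {z : ℂ} (hz : z.im ≠ 0) :
    z ∈ (Complex.ofReal '' S)ᶜ := by
  rintro ⟨x, -, rfl⟩
  exact hz (Complex.ofReal_im x)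

theorem frequently_im_ne_zero (z : ℂ) : ∃ᶠ w in 𝓝 z, w.im ≠ 0 := by
  by_cases hz : z.im = 0
  · have h : Tendsto (fun t : ℝ => z + t * Complex.I) (𝓝[≠] 0) (𝓝 (z + (0 : ℝ) * Complex.I)) :=
      (Continuous.tendsto (by fun_prop) _).mono_left nhdsWithin_le_nhds
    rw [Complex.ofReal_zero, zero_mul, add_zero] at h
    refine h.frequently (Eventually.frequently ?_)
    filter_upwards [self_mem_nhdsWithin] with t ht
    simpa [hz] using ht
  · exact Eventually.frequently (p := fun w : ℂ => w.im ≠ 0)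
      (Complex.continuous_im.continuousAt.eventually_ne hz)

/-- A function holomorphic off the real line that vanishes near a non-real point vanishes on the
half-plane of this point. -/
theorem eq_zero_on_halfPlane {S : Set ℝ} {φ : ℂ → E}
    (hφ : AnalyticOnNhd ℂ φ (Complex.ofReal '' S)ᶜ) {w : ℂ} (h0 : φ =ᶠ[𝓝 w] 0)
    {z : ℂ} (hz : 0 < z.im * w.im) : φ z = 0 := by
  have hw : w.im ≠ 0 := by rintro h; simp [h] at hz
  have hconv : Convex ℝ {z : ℂ | 0 < z.im * w.im} := by
    have : IsLinearMap ℝ (fun z : ℂ => z.im * w.im) :=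
      ⟨fun a b => by simp [add_mul], fun c a => by simp [mul_assoc]⟩
    exact convex_halfSpace_gt this 0
  have hsub : {z : ℂ | 0 < z.im * w.im} ⊆ (Complex.ofReal '' S)ᶜ := fun u hu =>
    mem_compl_ofReal_image_of_im_ne_zero S (by rintro h; simp [h] at hu)
  exact (hφ.mono hsub).eqOn_zero_of_preconnected_of_eventuallyEq_zero hconv.isPreconnected
    (mul_self_pos.2 hw) h0 hz

theorem exists_im_mul_pos_of_eventually (l : ℝ) {p : ℂ → Prop} (hp : ∀ᶠ z in 𝓝 (l : ℂ), p z)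
    {c : ℝ} (hc : c ≠ 0) : ∃ w : ℂ, w.re = l ∧ 0 < w.im * c ∧ ∀ᶠ z in 𝓝 w, p z := by
  have h : Tendsto (fun t : ℝ => (l : ℂ) + t * (c * Complex.I)) (𝓝[>] 0) (𝓝 (l : ℂ)) := by
    have : Tendsto (fun t : ℝ => (l : ℂ) + t * (c * Complex.I)) (𝓝 0)
        (𝓝 ((l : ℂ) + (0 : ℝ) * (c * Complex.I))) := Continuous.tendsto (by fun_prop) _
    simpa using this.mono_left nhdsWithin_le_nhds
  obtain ⟨t, ht, ht0⟩ := ((h.eventually hp.eventually_nhds).and self_mem_nhdsWithin).exists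
  refine ⟨_, by simp, ?_, ht⟩
  have : 0 < t * (c * c) := mul_pos ht0 (mul_self_pos.2 hc)
  simpa [mul_assoc] using this

/-- The domain may be disconnected, but every neighbourhood of l meets both half-planes, so φ
vanishes on each of them. Real points of the domain follow by continuity. -/
theorem eq_zero_of_eventually_eq_zero_near_real {S : Set ℝ} (hS : IsClosed S) {φ : ℂ → E}
    (hφ : AnalyticOnNhd ℂ φ (Complex.ofReal '' S)ᶜ) {l : ℝ}
    (h : ∀ᶠ z in 𝓝 (l : ℂ), z ∈ (Complex.ofReal '' S)ᶜ → φ z = 0)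
    {z : ℂ} (hz : z ∈ (Complex.ofReal '' S)ᶜ) : φ z = 0 := by
  have key : ∀ u : ℂ, u.im ≠ 0 → φ u = 0 := by
    intro u hu
    obtain ⟨w, -, hw, hw'⟩ := exists_im_mul_pos_of_eventually l h hu
    have hwim : w.im ≠ 0 := by rintro h; simp [h] at hw
    refine eq_zero_on_halfPlane hφ (w := w) ?_ (by rwa [mul_comm])
    filter_upwards [hw', (isOpen_compl_ofReal_image hS).mem_nhds
      (mem_compl_ofReal_image_of_im_ne_zero S hwim)] with v hv hv' using hv hv'
  by_contra hne
  obtain ⟨u, hu, hu'⟩ := ((frequently_im_ne_zero z).and_eventually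
    ((hφ z hz).continuousAt.eventually_ne hne)).exists
  exact hu' (key u hu)

end IdentityPrinciple

/-! ### Left inverses up to rank one, and Cramer's rule -/

section Parametrix

variable {V : Type*} [NormedAddCommGroup V] [NormedSpace ℂ V]

/-- The operator `1 - (z - l) D`. -/
noncomputable def pencil (D : V →L[ℂ] V) (l z : ℂ) : V →L[ℂ] V := 1 - (z - l) • D

theorem pencil_apply (D : V →L[ℂ] V) (l z : ℂ) (f : V) : pencil D l z f = f - (z - l) • D f := by
  simp [pencil]

theorem analyticAt_pencil (D : V →L[ℂ] V) (l z : ℂ) : AnalyticAt ℂ (pencil D l) z := by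
  unfold pencil
  fun_prop

/-- Holomorphic families `B` of operators and `β` of vectors such that `B z` is a left inverse of
`1 - (z - l) D` up to the operator `(z - l) e(·) β z` of rank one. -/
structure IsLeftParametrix (D : V →L[ℂ] V) (e : V →L[ℂ] ℂ) (l : ℂ) (Ω : Set ℂ)
    (B : ℂ → V →L[ℂ] V) (β : ℂ → V) : Prop where
  analytic_op : AnalyticOnNhd ℂ B Ω
  analytic_vec : AnalyticOnNhd ℂ β Ω
  apply_pencil : ∀ z ∈ Ω, ∀ f, B z (pencil D l z f) = f + ((z - l) * e f) • β z

/-- The determinant of `1 + (z - l) e(·) β z`. -/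
noncomputable def rankOneDet (e : V →L[ℂ] ℂ) (l : ℂ) (β : ℂ → V) (z : ℂ) : ℂ :=
  1 + (z - l) * e (β z)

/-- The adjugate of `1 + (z - l) e(·) β z`, composed with `B z`. -/
noncomputable def adjugateParametrix (e : V →L[ℂ] ℂ) (l : ℂ) (B : ℂ → V →L[ℂ] V) (β : ℂ → V)
    (z : ℂ) (h : V) : V :=
  rankOneDet e l β z • B z h - ((z - l) * e (B z h)) • β z

/-- The function `z ↦ e ((1 - (z - l) D)⁻¹ f)`, with value `0` where the inverse does not exist. -/
noncomputable def resolventFunction (D : V →L[ℂ] V) (e : V →L[ℂ] ℂ) (l : ℂ) (f : V) (z : ℂ) : ℂ :=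
  e (Ring.inverse (pencil D l z) f)

theorem tendsto_pencil_apply (D : V →L[ℂ] V) (l : ℂ) {z : ℂ} {g : ℂ → V} {g₀ : V}
    (hg : Tendsto g (𝓝[≠] z) (𝓝 g₀)) :
    Tendsto (fun w => pencil D l w (g w)) (𝓝[≠] z) (𝓝 (pencil D l z g₀)) := by
  have hid : Tendsto (fun w : ℂ => w - l) (𝓝[≠] z) (𝓝 (z - l)) :=
    (tendsto_id.sub_const l).mono_left nhdsWithin_le_nhds
  simp only [pencil_apply]
  exact hg.sub (hid.smul ((D.continuous.tendsto g₀).comp hg))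

theorem eventually_isUnit_pencil [CompleteSpace V] (D : V →L[ℂ] V) (l : ℂ) {z : ℂ}
    (hz : IsUnit (pencil D l z)) : ∀ᶠ w in 𝓝 z, IsUnit (pencil D l w) :=
  (analyticAt_pencil D l z).continuousAt.eventually (Units.isOpen.mem_nhds hz)

theorem isUnit_pencil_self (D : V →L[ℂ] V) (l : ℂ) : IsUnit (pencil D l l) := by
  simp [pencil]

theorem analyticAt_resolventFunction [CompleteSpace V] (D : V →L[ℂ] V) (e : V →L[ℂ] ℂ) (l : ℂ)
    (f : V) {z : ℂ} (hz : IsUnit (pencil D l z)) : AnalyticAt ℂ (resolventFunction D e l f) z := by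
  have h1 : AnalyticAt ℂ (fun w => Ring.inverse (pencil D l w)) z := by
    obtain ⟨u, hu⟩ := hz
    have := analyticAt_inverse (𝕜 := ℂ) u
    rw [hu] at this
    exact this.comp (analyticAt_pencil D l z)
  have h2 : AnalyticAt ℂ (fun T : V →L[ℂ] V => e (T f)) (Ring.inverse (pencil D l z)) :=
    (e.comp (ContinuousLinearMap.apply ℂ V f)).analyticAt _
  exact AnalyticAt.comp (g := fun T : V →L[ℂ] V => e (T f)) h2 h1

theorem resolventFunction_eq_of_pencil_eq {D : V →L[ℂ] V} (e : V →L[ℂ] ℂ) {l z : ℂ} {f g : V}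
    (hz : IsUnit (pencil D l z)) (hg : pencil D l z g = f) :
    resolventFunction D e l f z = e g := by
  have : (Ring.inverse (pencil D l z) * pencil D l z) g = g := by
    rw [Ring.inverse_mul_cancel _ hz]; rfl
  rw [resolventFunction, ← hg]
  exact congrArg e this

namespace IsLeftParametrix

variable {D : V →L[ℂ] V} {e : V →L[ℂ] ℂ} {l : ℂ} {Ω : Set ℂ} {B : ℂ → V →L[ℂ] V} {β : ℂ → V}

theorem analyticOnNhd_rankOneDet (hB : IsLeftParametrix D e l Ω B β) :
    AnalyticOnNhd ℂ (rankOneDet e l β) Ω := by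
  intro z hz
  have h1 : AnalyticAt ℂ (fun w => e (β w)) z := (e.analyticAt _).comp (hB.analytic_vec z hz)
  exact analyticAt_const.add ((analyticAt_id.sub analyticAt_const).mul h1)

theorem analyticOnNhd_apply (hB : IsLeftParametrix D e l Ω B β) (h : V) :
    AnalyticOnNhd ℂ (fun z => B z h) Ω := fun z hz =>
  ((ContinuousLinearMap.apply ℂ V h).analyticAt _).comp (hB.analytic_op z hz)

theorem analyticOnNhd_eval_apply (hB : IsLeftParametrix D e l Ω B β) (h : V) :
    AnalyticOnNhd ℂ (fun z => e (B z h)) Ω := fun z hz =>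
  (e.analyticAt _).comp (hB.analyticOnNhd_apply h z hz)

theorem analyticOnNhd_adjugateParametrix (hB : IsLeftParametrix D e l Ω B β) (h : V) :
    AnalyticOnNhd ℂ (fun z => adjugateParametrix e l B β z h) Ω := by
  intro z hz
  have h1 := hB.analyticOnNhd_rankOneDet z hz
  have h2 := hB.analyticOnNhd_apply h z hz
  have h3 := hB.analyticOnNhd_eval_apply h z hz
  have h4 := hB.analytic_vec z hz
  exact (h1.smul h2).sub (((analyticAt_id.sub analyticAt_const).mul h3).smul h4)

theorem eval_apply_pencil (hB : IsLeftParametrix D e l Ω B β) {z : ℂ} (hz : z ∈ Ω) (f : V) :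
    e (B z (pencil D l z f)) = rankOneDet e l β z * e f := by
  rw [hB.apply_pencil z hz, rankOneDet]
  simp
  ring

theorem adjugateParametrix_pencil (hB : IsLeftParametrix D e l Ω B β) {z : ℂ} (hz : z ∈ Ω) (f : V) :
    adjugateParametrix e l B β z (pencil D l z f) = rankOneDet e l β z • f := by
  rw [adjugateParametrix, hB.eval_apply_pencil hz, hB.apply_pencil z hz]
  module

theorem rankOneDet_eq_zero_of_pencil_eq_zero (hB : IsLeftParametrix D e l Ω B β) {z : ℂ}
    (hz : z ∈ Ω) {f : V} (hf : f ≠ 0) (h : pencil D l z f = 0) : rankOneDet e l β z = 0 := by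
  have := hB.adjugateParametrix_pencil hz f
  rw [h] at this
  simpa [adjugateParametrix, hf] using this.symm

end IsLeftParametrix

end Parametrix

/-! ### Invertibility and meromorphy of the resolvent off a closed real set -/

section Continuation

variable {V : Type*} [NormedAddCommGroup V] [NormedSpace ℂ V] [CompleteSpace V]
  {D : V →L[ℂ] V} {e : V →L[ℂ] ℂ} {l : ℝ} {S : Set ℝ} {B : ℂ → V →L[ℂ] V} {β : ℂ → V}

namespace IsLeftParametrix

/-- Near l the pencil is invertible, so there the left identity `adjugateParametrix_pencil` is also
a right identity; both sides are holomorphic in z, and the identity principle spreads it. -/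
theorem pencil_adjugateParametrix (hS : IsClosed S)
    (hB : IsLeftParametrix D e l (Complex.ofReal '' S)ᶜ B β) {z : ℂ}
    (hz : z ∈ (Complex.ofReal '' S)ᶜ) (h : V) :
    pencil D l z (adjugateParametrix e l B β z h) = rankOneDet e l β z • h := by
  have hφ : AnalyticOnNhd ℂ (fun z => pencil D l z (adjugateParametrix e l B β z h)
      - rankOneDet e l β z • h) (Complex.ofReal '' S)ᶜ := by
    intro w hw
    have h1 := hB.analyticOnNhd_rankOneDet w hw
    have h2 := hB.analyticOnNhd_adjugateParametrix h w hw
    have h3 : AnalyticAt ℂ (fun z => D (adjugateParametrix e l B β z h)) w :=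
      (D.analyticAt _).comp h2
    simp only [pencil_apply]
    exact (h2.sub ((analyticAt_id.sub analyticAt_const).smul h3)).sub (h1.smul analyticAt_const)
  refine sub_eq_zero.1 (eq_zero_of_eventually_eq_zero_near_real hS hφ (l := l) ?_ hz)
  filter_upwards [eventually_isUnit_pencil D l (isUnit_pencil_self D l)] with w hw hwΩ
  obtain ⟨f, hf⟩ : ∃ f, pencil D l w f = h := by
    refine ⟨Ring.inverse (pencil D l w) h, ?_⟩
    have : (pencil D l w * Ring.inverse (pencil D l w)) h = h := by
      rw [Ring.mul_inverse_cancel _ hw]; rfl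
    exact this
  rw [← hf, hB.adjugateParametrix_pencil hwΩ]
  simp

/-- If the determinant is nonzero at points straight above and below `l`, its zeros are isolated. -/
theorem eventually_rankOneDet_ne_zero
    (hB : IsLeftParametrix D e l (Complex.ofReal '' S)ᶜ B β)
    (hdet : ∀ z : ℂ, z.im ≠ 0 → z.re = l → IsUnit (pencil D l z) → rankOneDet e l β z ≠ 0)
    {z : ℂ} (hz : z ∈ (Complex.ofReal '' S)ᶜ) : ∀ᶠ w in 𝓝[≠] z, rankOneDet e l β w ≠ 0 := by
  refine (hB.analyticOnNhd_rankOneDet z hz).eventually_eq_zero_or_eventually_ne_zero.resolve_left ?_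
  intro h0
  obtain ⟨u, hu, hu'⟩ := ((frequently_im_ne_zero z).and_eventually h0.eventually_nhds).exists
  -- A point l + it in the same half-plane as u, so close to l that the pencil is invertible there.
  obtain ⟨w, hw, hw', hw''⟩ := exists_im_mul_pos_of_eventually l
    (eventually_isUnit_pencil D l (isUnit_pencil_self D l)) hu
  exact hdet w (by rintro h; simp [h] at hw') hw hw''.self_of_nhds
    (eq_zero_on_halfPlane hB.analyticOnNhd_rankOneDet hu' hw')

theorem surjective_pencil_of_rankOneDet_ne_zero (hS : IsClosed S)
    (hB : IsLeftParametrix D e l (Complex.ofReal '' S)ᶜ B β) {z : ℂ}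
    (hz : z ∈ (Complex.ofReal '' S)ᶜ) (ha : rankOneDet e l β z ≠ 0) :
    Function.Surjective (pencil D l z) := fun h =>
  ⟨(rankOneDet e l β z)⁻¹ • adjugateParametrix e l B β z h, by
    rw [map_smul, hB.pencil_adjugateParametrix hS hz, inv_smul_smul₀ ha]⟩

theorem isUnit_pencil_of_rankOneDet_ne_zero (hS : IsClosed S)
    (hB : IsLeftParametrix D e l (Complex.ofReal '' S)ᶜ B β) {z : ℂ}
    (hz : z ∈ (Complex.ofReal '' S)ᶜ) (ha : rankOneDet e l β z ≠ 0) : IsUnit (pencil D l z) := by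
  refine ContinuousLinearMap.isUnit_iff_bijective.2
    ⟨(injective_iff_map_eq_zero _).2 fun f hf => ?_,
      hB.surjective_pencil_of_rankOneDet_ne_zero hS hz ha⟩
  by_contra hne
  exact ha (hB.rankOneDet_eq_zero_of_pencil_eq_zero hz hne hf)

theorem resolventFunction_eq_div (hS : IsClosed S)
    (hB : IsLeftParametrix D e l (Complex.ofReal '' S)ᶜ B β) {z : ℂ}
    (hz : z ∈ (Complex.ofReal '' S)ᶜ) (ha : rankOneDet e l β z ≠ 0) (h : V) :
    resolventFunction D e l h z = e (B z h) / rankOneDet e l β z := by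
  obtain ⟨f, rfl⟩ := hB.surjective_pencil_of_rankOneDet_ne_zero hS hz ha h
  rw [resolventFunction_eq_of_pencil_eq e (hB.isUnit_pencil_of_rankOneDet_ne_zero hS hz ha) rfl,
    hB.eval_apply_pencil hz, mul_div_cancel_left₀ _ ha]

theorem meromorphicAt_resolventFunction (hS : IsClosed S)
    (hB : IsLeftParametrix D e l (Complex.ofReal '' S)ᶜ B β)
    (hdet : ∀ z : ℂ, z.im ≠ 0 → z.re = l → IsUnit (pencil D l z) → rankOneDet e l β z ≠ 0)
    {z : ℂ} (hz : z ∈ (Complex.ofReal '' S)ᶜ) (h : V) :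
    MeromorphicAt (resolventFunction D e l h) z := by
  refine MeromorphicAt.congr (f := fun z => e (B z h) / rankOneDet e l β z)
    ((hB.analyticOnNhd_eval_apply h z hz).meromorphicAt.div
      (hB.analyticOnNhd_rankOneDet z hz).meromorphicAt) ?_
  filter_upwards [hB.eventually_rankOneDet_ne_zero hdet hz,
    nhdsWithin_le_nhds ((isOpen_compl_ofReal_image hS).mem_nhds hz)] with w hw hwΩ
  exact (hB.resolventFunction_eq_div hS hwΩ hw h).symm

/-- At a zero of the determinant a, the equation is solved at nearby w by a⁻¹ times the adjugate,
that is by B h - (e(B h)/a)(w - l)β. Only the scalar e(B h)/a can blow up as w → z, and blow-up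
would produce a kernel element. -/
theorem isUnit_pencil_of_injective (hS : IsClosed S)
    (hB : IsLeftParametrix D e l (Complex.ofReal '' S)ᶜ B β)
    (hdet : ∀ z : ℂ, z.im ≠ 0 → z.re = l → IsUnit (pencil D l z) → rankOneDet e l β z ≠ 0)
    {z : ℂ} (hz : z ∈ (Complex.ofReal '' S)ᶜ) (hinj : ∀ f, pencil D l z f = 0 → f = 0) :
    IsUnit (pencil D l z) := by
  by_cases ha : rankOneDet e l β z ≠ 0
  · exact hB.isUnit_pencil_of_rankOneDet_ne_zero hS hz ha
  push Not at ha
  refine ContinuousLinearMap.isUnit_iff_bijective.2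
    ⟨(injective_iff_map_eq_zero _).2 hinj, fun h => ?_⟩
  have hev : ∀ᶠ w in 𝓝[≠] z, rankOneDet e l β w ≠ 0 ∧ w ∈ (Complex.ofReal '' S)ᶜ :=
    (hB.eventually_rankOneDet_ne_zero hdet hz).and
      (nhdsWithin_le_nhds ((isOpen_compl_ofReal_image hS).mem_nhds hz))
  have hα := hB.analyticOnNhd_eval_apply h z hz
  have hd := hB.analyticOnNhd_rankOneDet z hz
  have hmer : MeromorphicAt (fun w => e (B w h) / rankOneDet e l β w) z :=
    hα.meromorphicAt.div hd.meromorphicAt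
  have hBh : Tendsto (fun w => B w h) (𝓝[≠] z) (𝓝 (B z h)) :=
    (hB.analyticOnNhd_apply h z hz).continuousAt.tendsto.mono_left nhdsWithin_le_nhds
  have hβ : Tendsto (fun w : ℂ => (w - l) • β w) (𝓝[≠] z) (𝓝 ((z - l) • β z)) := by
    have h1 := (hB.analytic_vec z hz).continuousAt
    have : ContinuousAt (fun w : ℂ => (w - l) • β w) z := by fun_prop
    exact this.tendsto.mono_left nhdsWithin_le_nhds
  by_cases ho : 0 ≤ meromorphicOrderAt (fun w => e (B w h) / rankOneDet e l β w) z
  -- No pole: the solutions at w converge, and their limit solves the equation at z.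
  · obtain ⟨c, hc⟩ := (tendsto_nhds_iff_meromorphicOrderAt_nonneg hmer).2 ho
    have hlim : Tendsto (fun w => pencil D l w (B w h -
        (e (B w h) / rankOneDet e l β w) • ((w - l) • β w))) (𝓝[≠] z)
        (𝓝 (pencil D l z (B z h - c • ((z - l) • β z)))) := 
      tendsto_pencil_apply D l (hBh.sub (hc.smul hβ))
    refine ⟨_, tendsto_nhds_unique hlim (tendsto_const_nhds.congr' ?_)⟩
    filter_upwards [hev] with w hw
    have h1 : B w h - (e (B w h) / rankOneDet e l β w) • ((w - l) • β w) =
        (rankOneDet e l β w)⁻¹ • adjugateParametrix e l B β w h := by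
      rw [adjugateParametrix, smul_sub, inv_smul_smul₀ hw.1]
      module
    rw [h1, map_smul, hB.pencil_adjugateParametrix hS hw.2, inv_smul_smul₀ hw.1]
  · push Not at ho
    -- Pole: the solutions divided by the scalar converge to -(z - l)β(z), while the right-hand
    -- sides tend to 0. This limit is therefore in the kernel.
    have hc := (tendsto_cobounded_iff_meromorphicOrderAt_neg hmer).2 ho
    have hc0 : ∀ᶠ w in 𝓝[≠] z, e (B w h) / rankOneDet e l β w ≠ 0 := by
      filter_upwards [hc.eventually (Bornology.eventually_ne_cobounded 0)] with w hw using hw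
    have hci := tendsto_inv₀_cobounded.comp hc
    have hlim : Tendsto (fun w => pencil D l w ((e (B w h) / rankOneDet e l β w)⁻¹ • B w h -
        (w - l) • β w)) (𝓝[≠] z) (𝓝 (pencil D l z ((0 : ℂ) • B z h - (z - l) • β z))) :=
      tendsto_pencil_apply D l ((hci.smul hBh).sub hβ)
    have hzero : pencil D l z ((0 : ℂ) • B z h - (z - l) • β z) = 0 := by
      have h0 : Tendsto (fun w => (e (B w h) / rankOneDet e l β w)⁻¹ • h) (𝓝[≠] z) (𝓝 0) := by
        simpa using hci.smul_const h
      refine tendsto_nhds_unique hlim (h0.congr' ?_)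
      filter_upwards [hev, hc0] with w hw hw0
      have hα0 : e (B w h) ≠ 0 := fun h0 => hw0 (by simp [h0])
      have h1 : (e (B w h) / rankOneDet e l β w)⁻¹ • B w h - (w - l) • β w =
          (e (B w h))⁻¹ • adjugateParametrix e l B β w h := by
        rw [adjugateParametrix, smul_sub, mul_comm, mul_smul, inv_smul_smul₀ hα0, inv_div,
          div_eq_inv_mul, mul_smul]
      rw [h1, map_smul, hB.pencil_adjugateParametrix hS hw.2, inv_div, div_eq_inv_mul, mul_smul]
    -- Injectivity gives (z - l)β(z) = 0, so the determinant at z would be 1 instead of 0.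
    have := congrArg e (hinj _ hzero)
    rw [rankOneDet] at ha
    have h0 : (z - l) * e (β z) = 0 := by simpa using this
    rw [h0, add_zero] at ha
    exact absurd ha one_ne_zero

end IsLeftParametrix

end Continuation

/-! ### Holomorphic operator families -/

section OperatorFamilies

variable {E E' F G : Type*} [NormedAddCommGroup E] [NormedSpace ℂ E] [NormedAddCommGroup E']
  [NormedSpace ℂ E'] [NormedAddCommGroup F] [NormedSpace ℂ F] [NormedAddCommGroup G]
  [NormedSpace ℂ G] {R : ℂ → E →L[ℂ] E'} {z : ℂ}

theorem analyticAt_comp_comp (hR : AnalyticAt ℂ R z) (A : E' →L[ℂ] G) (C : F →L[ℂ] E) :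
    AnalyticAt ℂ (fun w => A ∘L R w ∘L C) z := by
  let Φ : (E →L[ℂ] E') →L[ℂ] (F →L[ℂ] G) := (A.postcomp F) ∘L (C.precomp E')
  exact (Φ.analyticAt (R z)).comp hR

theorem analyticAt_family_apply (hR : AnalyticAt ℂ R z) {g : ℂ → E} (hg : AnalyticAt ℂ g z) :
    AnalyticAt ℂ (fun w => R w (g w)) z :=
  AnalyticAt.comp (g := fun p : (E →L[ℂ] E') × E => p.1 p.2) (f := fun w => (R w, g w))
    ((ContinuousLinearMap.id ℂ (E →L[ℂ] E')).analyticAt_bilinear (R z, g z)) (hR.prod hg)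

theorem analyticAt_one_add_smul {R : ℂ → E →L[ℂ] E} (hR : AnalyticAt ℂ R z) (l : ℂ) :
    AnalyticAt ℂ (fun w => 1 + (w - l) • R w) z :=
  analyticAt_const.add ((analyticAt_id.sub analyticAt_const).smul hR)

end OperatorFamilies

/-! ### Multiplication by 1/(x - z) on L² -/

section MultiplicationOperator

variable {U : Set ℝ} (ν : Measure U)

theorem memLp_top_inv_sub {z : ℂ} (hz : z ∈ (Complex.ofReal '' closure U)ᶜ) :
    MemLp (fun x : U => (((x : ℝ) : ℂ) - z)⁻¹) ∞ ν := by
  obtain ⟨r, hr, hball⟩ := Metric.isOpen_iff.1 (isOpen_compl_ofReal_image isClosed_closure) z hz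
  refine memLp_top_of_bound (C := r⁻¹) (Measurable.aestronglyMeasurable (by fun_prop))
    (Eventually.of_forall fun x => ?_)
  rw [norm_inv]
  refine inv_anti₀ hr ?_
  by_contra! hlt
  exact hball (by rwa [Metric.mem_ball, dist_eq_norm]) ⟨x, subset_closure x.2, rfl⟩

open Classical in
/-- Multiplication by `1 / (x - z)` on `L²` (zero, if this function is not bounded). -/
noncomputable def invSubMul (z : ℂ) : Lp ℂ 2 ν →L[ℂ] Lp ℂ 2 ν :=
  if h : MemLp (fun x : U => (((x : ℝ) : ℂ) - z)⁻¹) ∞ ν then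
    (ContinuousLinearMap.mul ℂ ℂ).holderL ν ∞ 2 2 (h.toLp _) else 0

variable {ν}

theorem coeFn_invSubMul {z : ℂ} (hz : z ∈ (Complex.ofReal '' closure U)ᶜ) (g : Lp ℂ 2 ν) :
    invSubMul ν z g =ᵐ[ν] fun x => (((x : ℝ) : ℂ) - z)⁻¹ * g x := by
  have h := memLp_top_inv_sub ν hz
  rw [invSubMul, dif_pos h]
  filter_upwards [(ContinuousLinearMap.mul ℂ ℂ).coeFn_holder (r := 2) (h.toLp _) g,
    h.coeFn_toLp] with x hx hx'
  rw [ContinuousLinearMap.holderL_apply_apply, hx, hx']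
  rfl

theorem sub_ne_zero_of_mem_compl {z : ℂ} (hz : z ∈ (Complex.ofReal '' closure U)ᶜ) (x : U) :
    ((x : ℝ) : ℂ) - z ≠ 0 := fun h => hz ⟨x, subset_closure x.2, sub_eq_zero.1 h⟩

/-- A form of the resolvent identity: for z near w it expresses the multiplication at z through an
inverse that is holomorphic in z. -/
theorem invSubMul_mul_one_sub {z w : ℂ} (hz : z ∈ (Complex.ofReal '' closure U)ᶜ)
    (hw : w ∈ (Complex.ofReal '' closure U)ᶜ) :
    invSubMul ν z * (1 - (z - w) • invSubMul ν w) = invSubMul ν w := by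
  ext1 g
  apply Lp.ext
  have h1 : (1 - (z - w) • invSubMul ν w) g = g - (z - w) • invSubMul ν w g := by simp
  rw [mul_apply_eq_comp, h1]
  filter_upwards [coeFn_invSubMul hz (g - (z - w) • invSubMul ν w g), coeFn_invSubMul hw g,
    Lp.coeFn_sub g ((z - w) • invSubMul ν w g), Lp.coeFn_smul (z - w) (invSubMul ν w g)]
    with x h1 h2 h3 h4
  have hz' := sub_ne_zero_of_mem_compl hz x
  have hw' := sub_ne_zero_of_mem_compl hw x
  rw [h1, h3, Pi.sub_apply, h4, Pi.smul_apply, h2, smul_eq_mul]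
  field_simp
  ring

theorem analyticOnNhd_invSubMul :
    AnalyticOnNhd ℂ (invSubMul ν) (Complex.ofReal '' closure U)ᶜ := by
  intro w hw
  let T : ℂ → Lp ℂ 2 ν →L[ℂ] Lp ℂ 2 ν := pencil (invSubMul ν w) w
  have hT : AnalyticAt ℂ (fun z => Ring.inverse (T z)) w := by
    obtain ⟨u, hu⟩ := isUnit_pencil_self (invSubMul ν w) w
    have := analyticAt_inverse (𝕜 := ℂ) u
    rw [hu] at this
    exact this.comp (analyticAt_pencil _ w w)
  refine (analyticAt_const.mul hT : AnalyticAt ℂ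
    (fun z => invSubMul ν w * Ring.inverse (T z)) w).congr ?_
  filter_upwards [eventually_isUnit_pencil _ w (isUnit_pencil_self (invSubMul ν w) w),
    (isOpen_compl_ofReal_image isClosed_closure).mem_nhds hw] with z hz hz'
  have h := invSubMul_mul_one_sub (ν := ν) hz' hw
  change invSubMul ν z * T z = _ at h
  change invSubMul ν w * Ring.inverse (T z) = _
  rw [← h, mul_assoc, Ring.mul_inverse_cancel _ hz, mul_one]

end MultiplicationOperator

/-! ### The parametrix from compression, and its determinant -/

section DivisionParametrix

variable {U : Set ℝ} {ν : Measure U} {V : Submodule ℂ (Lp ℂ 2 ν)}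
  {D : V →L[ℂ] V} {e : V →L[ℂ] ℂ} {l : ℝ} {v : V}

theorem coeFn_pencil (D : V →L[ℂ] V) (l z : ℂ) (f : V) :
    ∀ᵐ x ∂ν, (pencil D l z f).1 x = f.1 x - (z - l) * (D f).1 x := by
  have h1 : (pencil D l z f).1 = f.1 - (z - l) • (D f).1 := by rw [pencil_apply]; rfl
  rw [h1]
  filter_upwards [Lp.coeFn_sub f.1 ((z - l) • (D f).1), Lp.coeFn_smul (z - l) (D f).1] with x h2 h3
  rw [h2, Pi.sub_apply, h3, Pi.smul_apply, smul_eq_mul]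

variable [V.HasOrthogonalProjection]

variable (V) in
/-- The compression of multiplication by `(x - l) / (x - z)` to `V`. -/
noncomputable def compression (l z : ℂ) : V →L[ℂ] V :=
  1 + (z - l) • (V.orthogonalProjectionOnto ∘L invSubMul ν z ∘L V.subtypeL)

theorem compression_apply (l z : ℂ) (h : V) :
    compression V l z h = h + (z - l) • V.orthogonalProjectionOnto (invSubMul ν z h) := by
  simp [compression]

/-- The projection of `1 / (x - z)` to `V`. -/
noncomputable def projectedKernel (D : V →L[ℂ] V) (l : ℂ) (v : V) (z : ℂ) : V :=
  V.orthogonalProjectionOnto (invSubMul ν z (pencil D l z v)) - D v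

/-- Multiplying the pencil by (x - l)/(x - z) gives f + (z - l)f(l)/(x - z). The constant 1 need not
be in L², so 1/(x - z) is written as (1 - (z - l)D)v/(x - z) - D v with v(l) = 1, which is in L² and
visibly holomorphic in z. -/
theorem isLeftParametrix_compression
    (hD : ∀ f : V, ∀ᵐ x : U ∂ν, (((x : ℝ) : ℂ) - l) * (D f).1 x = f.1 x - e f) (hv : e v = 1) :
    IsLeftParametrix D e l (Complex.ofReal '' closure U)ᶜ (compression V l)
      (projectedKernel D l v) where
  analytic_op z hz := by
    have h1 := analyticAt_comp_comp (analyticOnNhd_invSubMul (ν := ν) z hz) V.orthogonalProjectionOnto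
      V.subtypeL
    exact analyticAt_one_add_smul h1 l
  analytic_vec z hz := by
    have h1 : AnalyticAt ℂ (fun w => V.subtypeL (pencil D l w v)) z :=
      analyticAt_family_apply (analyticAt_const (v := V.subtypeL))
        (analyticAt_family_apply (analyticAt_pencil D l z) analyticAt_const)
    have h2 := analyticAt_family_apply (analyticAt_const (v := V.orthogonalProjectionOnto))
      (analyticAt_family_apply (analyticOnNhd_invSubMul z hz) h1)
    exact h2.sub analyticAt_const
  apply_pencil z hz f := by
    have key : (pencil D l z f).1 + (z - l) • invSubMul ν z (pencil D l z f).1 =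
        f.1 + ((z - l) * e f) • (invSubMul ν z (pencil D l z v).1 - (D v).1) := by
      apply Lp.ext
      filter_upwards [Lp.coeFn_add (pencil D l z f).1 ((z - l) • invSubMul ν z (pencil D l z f).1),
        Lp.coeFn_smul (z - l) (invSubMul ν z (pencil D l z f).1),
        coeFn_invSubMul hz (pencil D l z f).1, coeFn_pencil D l z f, coeFn_pencil D l z v, hD v,
        Lp.coeFn_add f.1
          (((z - l) * e f) • (invSubMul ν z (pencil D l z v).1 - (D v).1)),
        Lp.coeFn_smul ((z - l) * e f) (invSubMul ν z (pencil D l z v).1 - (D v).1),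
        Lp.coeFn_sub (invSubMul ν z (pencil D l z v).1) (D v).1,
        coeFn_invSubMul hz (pencil D l z v).1, hD f]
        with x h1 h2 h3 h4 h5 h6 h7 h8 h9 h10 h11
      rw [h1, h7, Pi.add_apply, Pi.add_apply, h2, h8, Pi.smul_apply, Pi.smul_apply, h9,
        Pi.sub_apply, h3, h10, h4, h5, smul_eq_mul, smul_eq_mul]
      rw [hv] at h6
      have hx := sub_ne_zero_of_mem_compl hz x
      field_simp
      linear_combination (-(z - l)) * h11 + ((z - l) * e f) * h6
    have := congrArg V.orthogonalProjectionOnto key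
    simp only [map_add, map_smul, map_sub,
      Submodule.orthogonalProjectionOnto_mem_subspace_eq_self] at this
    rw [compression_apply, projectedKernel, this]

theorem inner_apply_im_eq_zero {g y : Lp ℂ 2 ν}
    (h : ∀ᵐ x : U ∂ν, y x = (((x : ℝ) : ℂ) - l) * g x) : (inner ℂ g y).im = 0 := by
  have h1 : inner ℂ g y = ∫ x : U, (((x : ℝ) - l) * ‖g x‖ ^ 2 : ℝ) ∂ν := by
    rw [L2.inner_def]
    refine (integral_congr_ae ?_).trans integral_ofReal
    filter_upwards [h] with x hx
    rw [hx, RCLike.inner_apply]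
    have := RCLike.mul_conj (g x)
    push_cast
    rw [mul_assoc, this]
    simp
  rw [h1, Complex.ofReal_im]

/-- If the determinant vanished, surjectivity of the pencil would give e ∘ B = 0. Applied to the
reproducing kernel k at l, this says that k is orthogonal to y = (x - l)g, where g = k/(x - z).
Since k = y - (z - l)g, ‖y‖² is a real number times the purely imaginary conjugate of z - l, so y =
0. As l is not an atom, k = 0, contradicting e(v) = 1. -/
theorem rankOneDet_compression_ne_zero [CompleteSpace V] (hν : ∀ x, ν {x} = 0)
    (hD : ∀ f : V, ∀ᵐ x : U ∂ν, (((x : ℝ) : ℂ) - l) * (D f).1 x = f.1 x - e f) (hv : e v = 1)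
    {z : ℂ} (hz : z.im ≠ 0) (hre : z.re = l) (hu : IsUnit (pencil D l z)) :
    rankOneDet e l (projectedKernel D l v) z ≠ 0 := by
  intro ha
  have hzΩ := mem_compl_ofReal_image_of_im_ne_zero (closure U) hz
  have hB := isLeftParametrix_compression (v := v) hD hv
  let k : V := (InnerProductSpace.toDual ℂ V).symm e
  have hk : ∀ f, e f = inner ℂ k f := fun f => (InnerProductSpace.toDual_symm_apply).symm
  have hek : e (compression V l z k) = 0 := by
    obtain ⟨f, hf⟩ := (ContinuousLinearMap.isUnit_iff_bijective.1 hu).2 k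
    rw [← hf, hB.eval_apply_pencil hzΩ, ha, zero_mul]
  set g := invSubMul ν z k.1
  set y : Lp ℂ 2 ν := k.1 + (z - l) • g with hy
  have hgk : ∀ᵐ x : U ∂ν, k.1 x = (((x : ℝ) : ℂ) - z) * g x := by
    filter_upwards [coeFn_invSubMul hzΩ k.1] with x hx
    rw [hx, mul_inv_cancel_left₀ (sub_ne_zero_of_mem_compl hzΩ x)]
  have hyg : ∀ᵐ x : U ∂ν, y x = (((x : ℝ) : ℂ) - l) * g x := by
    filter_upwards [hgk, Lp.coeFn_add k.1 ((z - l) • g), Lp.coeFn_smul (z - l) g] with x h1 h2 h3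
    rw [h2, Pi.add_apply, h3, Pi.smul_apply, smul_eq_mul, h1]
    ring
  have hky : inner ℂ k.1 y = 0 := by
    have hP : e (V.orthogonalProjectionOnto g) = inner ℂ k.1 g := by
      rw [hk, Submodule.inner_orthogonalProjectionOnto_eq_of_mem_left]
    rw [compression_apply, map_add, map_smul, hP, hk] at hek
    rw [hy, inner_add_right, inner_smul_right]
    exact hek
  have hy0 : y = 0 := by
    have hyy : inner ℂ y y = (starRingEnd ℂ) (z - l) * inner ℂ g y := by
      have : k.1 = y - (z - l) • g := by rw [hy]; abel
      rw [this, inner_sub_left, inner_smul_left] at hky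
      exact sub_eq_zero.1 hky
    have h1 : (inner ℂ y y).re = 0 := by
      rw [hyy, Complex.mul_re, inner_apply_im_eq_zero hyg]
      simp [hre]
    exact inner_self_eq_zero.1 (Complex.ext h1 (inner_self_im (𝕜 := ℂ) y))
  have hk0 : k = 0 := by
    apply Subtype.ext
    apply Lp.ext
    have hl : ∀ᵐ x : U ∂ν, (x : ℝ) ≠ l := by
      by_cases hlU : l ∈ U
      · filter_upwards [measure_eq_zero_iff_ae_notMem.1 (hν ⟨l, hlU⟩)] with x hx hxl
        exact hx (Subtype.ext hxl)
      · exact Eventually.of_forall fun x hx => hlU (hx ▸ x.2)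
    rw [hy0] at hyg
    filter_upwards [hgk, hyg, hl, Lp.coeFn_zero ℂ 2 ν] with x h1 h2 h3 h4
    have h5 : ((x : ℝ) : ℂ) - l ≠ 0 := sub_ne_zero.2 (by exact_mod_cast h3)
    rw [h4] at h2
    have h6 : g x = 0 := (mul_eq_zero.1 h2.symm).resolve_left h5
    rw [h1, h6, mul_zero]
    exact h4.symm
  rw [hk, hk0, inner_zero_left] at hv
  exact zero_ne_one hv

end DivisionParametrix

/-! ### H as a closed subspace of L² and the division operator -/

section Classes

variable {μ : Measure ℝ} {U : Set ℝ} {H : Submodule ℂ (U → ℂ)}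

/-- The measure induced by `μ` on `U`. -/
noncomputable abbrev inducedMeasure (μ : Measure ℝ) (U : Set ℝ) : Measure U :=
  μ.comap ((↑) : U → ℝ)

theorem inducedMeasure_singleton [NullSingletonClass μ] (hU : MeasurableSet U) (x : U) :
    inducedMeasure μ U {x} = 0 := by
  rw [inducedMeasure, (MeasurableEmbedding.subtype_coe hU).comap_apply]
  simp

variable (μ H) in
/-- The classes in `L²` of the elements of `H`. -/
noncomputable def classes : Submodule ℂ (Lp ℂ 2 (inducedMeasure μ U)) where
  carrier := {h | ∃ f ∈ H, (h : U → ℂ) =ᵐ[inducedMeasure μ U] f}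
  add_mem' := by
    rintro a b ⟨f, hf, haf⟩ ⟨g, hg, hbg⟩
    exact ⟨f + g, H.add_mem hf hg, (Lp.coeFn_add a b).trans (haf.add hbg)⟩
  zero_mem' := ⟨0, H.zero_mem, Lp.coeFn_zero _ _ _⟩
  smul_mem' := by
    rintro c a ⟨f, hf, haf⟩
    exact ⟨c • f, H.smul_mem c hf, (Lp.coeFn_smul c a).trans (haf.const_smul c)⟩

/-- The representative in `H` of a class. -/
noncomputable def representative (h : classes μ H) : U → ℂ := h.2.choose

theorem representative_mem (h : classes μ H) : representative h ∈ H := h.2.choose_spec.1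

theorem coeFn_eq_representative (h : classes μ H) :
    (h.1 : U → ℂ) =ᵐ[inducedMeasure μ U] representative h := h.2.choose_spec.2

namespace IsReproducingKernelSubspace

/-- Evaluations are bounded by the L² norm, so each class has a single representative in H and point
values of classes make sense. -/
theorem eq_of_ae_eq (hH : IsReproducingKernelSubspace μ U H) {f g : U → ℂ} (hf : f ∈ H)
    (hg : g ∈ H) (h : f =ᵐ[inducedMeasure μ U] g) : f = g := by
  funext k
  obtain ⟨C, hC⟩ := hH.bounded_eval k
  have h0 : f - g =ᵐ[inducedMeasure μ U] 0 := by
    filter_upwards [h] with x hx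
    simp [hx]
  have := hC (f - g) (H.sub_mem hf hg)
  rw [eLpNorm_congr_ae h0] at this
  simpa [sub_eq_zero] using this

theorem representative_eq (hH : IsReproducingKernelSubspace μ U H) {h : classes μ H} {f : U → ℂ}
    (hf : f ∈ H) (hhf : (h.1 : U → ℂ) =ᵐ[inducedMeasure μ U] f) : representative h = f :=
  hH.eq_of_ae_eq (representative_mem h) hf ((coeFn_eq_representative h).symm.trans hhf)

theorem exists_representative_eq (hH : IsReproducingKernelSubspace μ U H) {f : U → ℂ}
    (hf : f ∈ H) : ∃ h : classes μ H, representative h = f :=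
  ⟨⟨(hH.memLp f hf).toLp f, f, hf, MemLp.coeFn_toLp _⟩,
    hH.representative_eq hf (hH.memLp f hf).coeFn_toLp⟩

theorem representative_add (hH : IsReproducingKernelSubspace μ U H) (a b : classes μ H) :
    representative (a + b) = representative a + representative b :=
  hH.representative_eq (H.add_mem (representative_mem a) (representative_mem b))
    ((Lp.coeFn_add a.1 b.1).trans ((coeFn_eq_representative a).add (coeFn_eq_representative b)))

theorem representative_smul (hH : IsReproducingKernelSubspace μ U H) (c : ℂ) (a : classes μ H) :
    representative (c • a) = c • representative a :=
  hH.representative_eq (H.smul_mem c (representative_mem a))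
    ((Lp.coeFn_smul c a.1).trans ((coeFn_eq_representative a).const_smul c))

theorem norm_representative_apply_le (hH : IsReproducingKernelSubspace μ U H) (k : U) :
    ∃ C : ℝ, ∀ h : classes μ H, ‖representative h k‖ ≤ C * ‖h‖ := by
  obtain ⟨C, hC⟩ := hH.bounded_eval k
  refine ⟨C, fun h => ?_⟩
  have h1 := hC _ (representative_mem h)
  rw [← eLpNorm_congr_ae (coeFn_eq_representative h), ← Lp.enorm_def] at h1
  have h2 : ‖representative h k‖₊ ≤ C * ‖h.1‖₊ := by
    rw [enorm_eq_nnnorm, enorm_eq_nnnorm] at h1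
    exact_mod_cast h1
  exact_mod_cast h2

/-- Evaluation at a point as a bounded functional on the classes. -/
noncomputable def evalCLM (hH : IsReproducingKernelSubspace μ U H) (k : U) :
    classes μ H →L[ℂ] ℂ :=
  LinearMap.mkContinuousOfExistsBound
    { toFun := fun h => representative h k
      map_add' := fun a b => by rw [hH.representative_add]; rfl
      map_smul' := fun c a => by rw [hH.representative_smul]; rfl }
    (hH.norm_representative_apply_le k)

theorem evalCLM_apply (hH : IsReproducingKernelSubspace μ U H) (k : U) (h : classes μ H) :
    hH.evalCLM k h = representative h k := rfl

theorem coeFn_eq_evalCLM (hH : IsReproducingKernelSubspace μ U H) (h : classes μ H) :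
    ∀ᵐ x ∂(inducedMeasure μ U), h.1 x = hH.evalCLM x h := coeFn_eq_representative h

theorem ext_ae (hH : IsReproducingKernelSubspace μ U H) {f g : classes μ H}
    (h : ∀ᵐ x ∂(inducedMeasure μ U), hH.evalCLM x f = hH.evalCLM x g) : f = g := by
  apply Subtype.ext
  apply Lp.ext
  filter_upwards [h, hH.coeFn_eq_evalCLM f, hH.coeFn_eq_evalCLM g] with x h1 h2 h3
  rw [h2, h1, h3]

theorem ext_off_point [NullSingletonClass μ] (hU : MeasurableSet U)
    (hH : IsReproducingKernelSubspace μ U H) (k : U) {f g : classes μ H}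
    (h : ∀ x : U, (((x : ℝ) : ℂ) - (k : ℝ)) * hH.evalCLM x f =
      (((x : ℝ) : ℂ) - (k : ℝ)) * hH.evalCLM x g) : f = g := by
  refine hH.ext_ae ?_
  filter_upwards [measure_eq_zero_iff_ae_notMem.1 (inducedMeasure_singleton (μ := μ) hU k)] with x hx
  refine mul_left_cancel₀ (sub_ne_zero.2 fun he => hx (Subtype.ext ?_)) (h x)
  exact_mod_cast he

theorem completeSpace_classes (hH : IsReproducingKernelSubspace μ U H) :
    CompleteSpace (classes μ H) := by
  have : IsClosed (classes μ H : Set (Lp ℂ 2 (inducedMeasure μ U))) := hH.isClosed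
  exact this.completeSpace_coe

/-- The operator `D` maps `f` to `(f - f k) / (x - k)`. -/
def IsDivisionOperator (hH : IsReproducingKernelSubspace μ U H)
    (D : classes μ H →L[ℂ] classes μ H) (k : U) : Prop :=
  ∀ (f : classes μ H) (x : U),
    (((x : ℝ) : ℂ) - (k : ℝ)) * hH.evalCLM x (D f) = hH.evalCLM x f - hH.evalCLM k f

/-- Division at a point of `U` is a bounded operator. -/
theorem exists_divisionCLM [NullSingletonClass μ] (hU : MeasurableSet U)
    (hH : IsReproducingKernelSubspace μ U H) (hdiv : StrongDivision H) (k : U) :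
    ∃ D : classes μ H →L[ℂ] classes μ H, hH.IsDivisionOperator D k := by
  have := hH.completeSpace_classes
  have hex : ∀ f : classes μ H, ∃ q : classes μ H, ∀ x : U,
      (((x : ℝ) : ℂ) - (k : ℝ)) * hH.evalCLM x q = hH.evalCLM x f - hH.evalCLM k f := by
    intro f
    obtain ⟨q, hq, hqx⟩ := hdiv k _ (representative_mem f)
    obtain ⟨q, rfl⟩ := hH.exists_representative_eq hq
    refine ⟨q, fun x => ?_⟩
    by_cases hx : ((x : ℝ) : ℂ) = (k : ℝ)
    · have : x = k := Subtype.ext (by exact_mod_cast hx)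
      simp [this]
    · rw [mul_comm]
      exact hqx x hx
  choose Q hQ using hex
  let D : classes μ H →ₗ[ℂ] classes μ H :=
    { toFun := Q
      map_add' := fun a b => hH.ext_off_point hU k fun x => by
        rw [hQ, map_add, map_add, map_add, mul_add, hQ, hQ]; ring
      map_smul' := fun c a => hH.ext_off_point hU k fun x => by
        simp only [hQ, map_smul, smul_eq_mul, RingHom.id_apply, mul_left_comm _ c]; ring }
  -- The graph is closed because the defining equation passes to the limit at each x through the
  -- continuous evaluations.
  refine ⟨⟨D, D.continuous_of_seq_closed_graph fun u a b hu hDu => ?_⟩, hQ⟩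
  refine hH.ext_off_point hU k fun x => ?_
  have h1 : Tendsto (fun n => (((x : ℝ) : ℂ) - (k : ℝ)) * hH.evalCLM x (Q (u n))) atTop
      (𝓝 ((((x : ℝ) : ℂ) - (k : ℝ)) * hH.evalCLM x b)) :=
    (((hH.evalCLM x).continuous.tendsto b).comp hDu).const_mul _
  have h2 : Tendsto (fun n => hH.evalCLM x (u n) - hH.evalCLM k (u n)) atTop
      (𝓝 (hH.evalCLM x a - hH.evalCLM k a)) :=
    (((hH.evalCLM x).continuous.tendsto a).comp hu).sub
      (((hH.evalCLM k).continuous.tendsto a).comp hu)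
  rw [show D a = Q a from rfl, hQ]
  simp only [hQ] at h1
  exact tendsto_nhds_unique h1 h2

/-! ### Kernel and inverse of the division pencil -/

section Pencil

variable {hH : IsReproducingKernelSubspace μ U H} {l : U} {D : classes μ H →L[ℂ] classes μ H}

theorem evalCLM_pencil (hD : hH.IsDivisionOperator D l)
    (z : ℂ) (f : classes μ H) (x : U) :
    (((x : ℝ) : ℂ) - (l : ℝ)) * hH.evalCLM x (pencil D (l : ℝ) z f) =
      (((x : ℝ) : ℂ) - z) * hH.evalCLM x f + (z - (l : ℝ)) * hH.evalCLM l f := by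
  rw [pencil_apply, map_sub, map_smul, smul_eq_mul]
  linear_combination (-(z - (l : ℝ))) * hD f x

theorem pencil_eq_zero_iff [NullSingletonClass μ] (hU : MeasurableSet U)
    (hD : hH.IsDivisionOperator D l)
    {z : ℂ} {f : classes μ H} : pencil D (l : ℝ) z f = 0 ↔
      ∀ x : U, (((x : ℝ) : ℂ) - z) * hH.evalCLM x f + (z - (l : ℝ)) * hH.evalCLM l f = 0 := by
  constructor
  · intro h x
    rw [← evalCLM_pencil hD, h, map_zero, mul_zero]
  · intro h
    refine hH.ext_off_point hU l fun x => ?_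
    rw [evalCLM_pencil hD, h, map_zero, mul_zero]

/-- A kernel element of the pencil that vanishes at the base point is zero. -/
theorem eq_zero_of_pencil_eq_zero [NullSingletonClass μ] (hU : MeasurableSet U)
    (hD : hH.IsDivisionOperator D l)
    {z : ℂ} {f : classes μ H} (h : pencil D (l : ℝ) z f = 0) (hl : hH.evalCLM l f = 0) :
    f = 0 := by
  rw [pencil_eq_zero_iff hU hD] at h
  simp only [hl, mul_zero, add_zero] at h
  by_cases hz : ∃ k : U, ((k : ℝ) : ℂ) = z
  · obtain ⟨k, rfl⟩ := hz
    exact hH.ext_off_point hU k fun x => by rw [h, map_zero, mul_zero]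
  · refine hH.ext_ae (Eventually.of_forall fun x => ?_)
    rw [map_zero]
    exact (mul_eq_zero.1 (h x)).resolve_left (sub_ne_zero.2 fun hx => hz ⟨x, hx⟩)

theorem pencil_injective_at [NullSingletonClass μ] (hU : MeasurableSet U)
    (hD : hH.IsDivisionOperator D l)
    (k : U) {f : classes μ H} (h : pencil D (l : ℝ) (k : ℝ) f = 0) : f = 0 := by
  -- At x = k the kernel equation reduces to (k - l)f(l) = 0; for k = l the pencil is the identity.
  have h1 := (pencil_eq_zero_iff hU hD).1 h k
  rw [sub_self, zero_mul, zero_add, mul_eq_zero] at h1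
  rcases h1 with h1 | h1
  · simpa [pencil_apply, h1] using h
  · exact eq_zero_of_pencil_eq_zero hU hD h h1

theorem exists_pencil_eq [NullSingletonClass μ] (hU : MeasurableSet U) (hdiv : StrongDivision H)
    (hD : hH.IsDivisionOperator D l)
    (k : U) (f : classes μ H) :
    ∃ g, pencil D (l : ℝ) (k : ℝ) g = f ∧ hH.evalCLM l g = hH.evalCLM k f := by
  obtain ⟨E, hE⟩ := hH.exists_divisionCLM hU hdiv k
  have hev : ∀ x : U, hH.evalCLM x (f + (((k : ℝ) : ℂ) - (l : ℝ)) • E f) =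
      hH.evalCLM x f + (((k : ℝ) : ℂ) - (l : ℝ)) * hH.evalCLM x (E f) := fun x => by
    rw [map_add, map_smul, smul_eq_mul]
  have hl : hH.evalCLM l (f + (((k : ℝ) : ℂ) - (l : ℝ)) • E f) = hH.evalCLM k f := by
    rw [hev]
    linear_combination - hE f l
  refine ⟨f + (((k : ℝ) : ℂ) - (l : ℝ)) • E f, hH.ext_off_point hU l fun x => ?_, hl⟩
  rw [evalCLM_pencil hD, hl, hev]
  linear_combination (((k : ℝ) : ℂ) - (l : ℝ)) * hE f x

theorem isUnit_pencil_at [NullSingletonClass μ] (hU : MeasurableSet U) (hdiv : StrongDivision H)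
    (hD : hH.IsDivisionOperator D l)
    (k : U) : IsUnit (pencil D (l : ℝ) (k : ℝ)) := by
  have := hH.completeSpace_classes
  exact ContinuousLinearMap.isUnit_iff_bijective.2
    ⟨(injective_iff_map_eq_zero _).2 fun f hf => pencil_injective_at hU hD k hf,
      fun f => (exists_pencil_eq hU hdiv hD k f).imp fun _ h => h.1⟩

theorem resolventFunction_at [NullSingletonClass μ] (hU : MeasurableSet U)
    (hdiv : StrongDivision H) (hD : hH.IsDivisionOperator D l)
    (k : U) (f : classes μ H) :
    resolventFunction D (hH.evalCLM l) (l : ℝ) f (k : ℝ) = hH.evalCLM k f := by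
  obtain ⟨g, hg, hgk⟩ := exists_pencil_eq hU hdiv hD k f
  rw [resolventFunction_eq_of_pencil_eq _ (isUnit_pencil_at hU hdiv hD k) hg, hgk]

/-- Kernels `1 / (x - z)` in `H` correspond to kernel elements of the pencil. -/
theorem exists_pencil_eq_zero_of_quotientMem [NullSingletonClass μ] (hU : MeasurableSet U)
    (hD : hH.IsDivisionOperator D l)
    {z : ℂ} (hz : QuotientMem H (fun _ => 1) z) (hzl : ((l : ℝ) : ℂ) ≠ z) :
    ∃ f, f ≠ 0 ∧ pencil D (l : ℝ) z f = 0 := by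
  obtain ⟨q, hq, hqx⟩ := hz
  obtain ⟨q, rfl⟩ := hH.exists_representative_eq hq
  simp only [← hH.evalCLM_apply] at hqx
  have hql := hqx l hzl
  refine ⟨q, ?_, ?_⟩
  · rintro rfl
    simp at hql
  · refine hH.ext_ae ?_
    have h1 : ∀ x : U, x ≠ l → ((x : ℝ) : ℂ) ≠ z →
        hH.evalCLM x (pencil D (l : ℝ) z q) = hH.evalCLM x 0 := fun x hx hxz => by
      refine mul_left_cancel₀ (sub_ne_zero.2 (?_ : ((x : ℝ) : ℂ) ≠ (l : ℝ))) ?_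
      · exact_mod_cast fun h => hx (Subtype.ext h)
      · rw [evalCLM_pencil hD, map_zero]
        linear_combination hqx x hxz - hql
    have h2 : ∀ᵐ x : U ∂(inducedMeasure μ U), ((x : ℝ) : ℂ) ≠ z := by
      by_cases hk : ∃ k : U, ((k : ℝ) : ℂ) = z
      · obtain ⟨k, rfl⟩ := hk
        filter_upwards [measure_eq_zero_iff_ae_notMem.1
          (inducedMeasure_singleton (μ := μ) hU k)] with x hx hxk
        exact hx (Subtype.ext (by exact_mod_cast hxk))
      · exact Eventually.of_forall fun x hx => hk ⟨x, hx⟩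
    filter_upwards [h2, measure_eq_zero_iff_ae_notMem.1
      (inducedMeasure_singleton (μ := μ) hU l)] with x hx hxl
    exact h1 x hxl hx

theorem quotientMem_of_pencil_eq_zero [NullSingletonClass μ] (hU : MeasurableSet U)
    (hD : hH.IsDivisionOperator D l)
    {z : ℂ} (hzl : ((l : ℝ) : ℂ) ≠ z) {f : classes μ H} (hf : f ≠ 0)
    (h : pencil D (l : ℝ) z f = 0) : QuotientMem H (fun _ => 1) z := by
  have hl : hH.evalCLM l f ≠ 0 := fun hl => hf (eq_zero_of_pencil_eq_zero hU hD h hl)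
  have hc : (((l : ℝ) : ℂ) - z) * hH.evalCLM l f ≠ 0 := mul_ne_zero (sub_ne_zero.2 hzl) hl
  refine ⟨((((l : ℝ) : ℂ) - z) * hH.evalCLM l f)⁻¹ • representative f,
    H.smul_mem _ (representative_mem f), fun x _ => ?_⟩
  have hx := (pencil_eq_zero_iff hU hD).1 h x
  rw [Pi.smul_apply, smul_eq_mul, ← hH.evalCLM_apply, mul_assoc, inv_mul_eq_one₀ hc]
  linear_combination -hx

end Pencil

end IsReproducingKernelSubspace

end Classes

/-! ### Poles, discreteness and extension -/

section Extension

variable {μ : Measure ℝ} [NullSingletonClass μ] {U : Set ℝ} {H : Submodule ℂ (U → ℂ)}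

theorem exists_mem_of_mem_closure_of_notMem_frontier {z : ℂ}
    (hz : z ∈ Complex.ofReal '' closure U) (hzb : z ∉ realBoundary U) :
    ∃ k : U, ((k : ℝ) : ℂ) = z ∧ U ∈ 𝓝 (k : ℝ) := by
  obtain ⟨x, hx, rfl⟩ := hz
  have hxi : x ∈ interior U := by
    by_contra h
    exact hzb ⟨x, ⟨hx, h⟩, rfl⟩
  exact ⟨⟨x, interior_subset hxi⟩, rfl, mem_interior_iff_mem_nhds.1 hxi⟩

theorem poleSet_subset (hU : MeasurableSet U) (hH : IsReproducingKernelSubspace μ U H)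
    (hdiv : StrongDivision H) : poleSet H ⊆ (Complex.ofReal '' closure U)ᶜ := by
  rintro z ⟨hzb, hz⟩ hzc
  obtain ⟨k, rfl, hk⟩ := exists_mem_of_mem_closure_of_notMem_frontier hzc hzb
  -- A base point other than k is needed: with base k the pencil at k is the identity and does not
  -- detect 1/(x - k).
  obtain ⟨y, hyU, hyk⟩ : ∃ y ∈ U, y ≠ (k : ℝ) := by
    have := (nhdsWithin_le_nhds (s := {(k : ℝ)}ᶜ) hk)
    obtain ⟨y, h1, h2⟩ := ((eventually_mem_set.2 this).and self_mem_nhdsWithin).exists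
    exact ⟨y, h1, h2⟩
  obtain ⟨D, hD⟩ := hH.exists_divisionCLM hU hdiv ⟨y, hyU⟩
  obtain ⟨f, hf, hf0⟩ := IsReproducingKernelSubspace.exists_pencil_eq_zero_of_quotientMem hU hD hz
    (by exact_mod_cast hyk)
  exact hf (IsReproducingKernelSubspace.pencil_injective_at hU hD k hf0)

theorem discrete_and_extension_of_ne_zero (hU : MeasurableSet U)
    (hH : IsReproducingKernelSubspace μ U H) (hdiv : StrongDivision H) {g : U → ℂ} (hg : g ∈ H)
    {l : U} (hgl : g l ≠ 0) :
    (∀ z : ℂ, z ∉ realBoundary U → ¬ AccPt z (𝓟 (poleSet H))) ∧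
      ∀ f ∈ H, ∃ F : ℂ → ℂ, IsMeromorphicExtension f (poleSet H) F := by
  have hcomplete := hH.completeSpace_classes
  obtain ⟨D, hD⟩ := hH.exists_divisionCLM hU hdiv l
  obtain ⟨w, rfl⟩ := hH.exists_representative_eq hg
  set v : classes μ H := (representative w l)⁻¹ • w with hv
  have hev : hH.evalCLM l v = 1 := by
    rw [hv, map_smul, hH.evalCLM_apply, smul_eq_mul, inv_mul_cancel₀ hgl]
  have hDae : ∀ f : classes μ H, ∀ᵐ x : U ∂(inducedMeasure μ U),
      (((x : ℝ) : ℂ) - (l : ℝ)) * (D f).1 x = f.1 x - hH.evalCLM l f := fun f => by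
    filter_upwards [hH.coeFn_eq_evalCLM f, hH.coeFn_eq_evalCLM (D f)] with x h1 h2
    rw [h1, h2, hD]
  have hB := isLeftParametrix_compression hDae hev
  have hdet : ∀ z : ℂ, z.im ≠ 0 → z.re = l → IsUnit (pencil D (l : ℝ) z) →
      rankOneDet (hH.evalCLM l) (l : ℝ) (projectedKernel D (l : ℝ) v) z ≠ 0 :=
    fun z hz hre hu => rankOneDet_compression_ne_zero (inducedMeasure_singleton hU) hDae hev hz hre hu
  have hne : ∀ z ∈ (Complex.ofReal '' closure U)ᶜ, ((l : ℝ) : ℂ) ≠ z := by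
    rintro z hz rfl
    exact hz ⟨l, subset_closure l.2, rfl⟩
  have hunit : ∀ z, z ∉ realBoundary U → z ∉ poleSet H → IsUnit (pencil D (l : ℝ) z) := by
    intro z hzb hzN
    by_cases hzc : z ∈ Complex.ofReal '' closure U
    · obtain ⟨k, rfl, -⟩ := exists_mem_of_mem_closure_of_notMem_frontier hzc hzb
      exact IsReproducingKernelSubspace.isUnit_pencil_at hU hdiv hD k
    · refine hB.isUnit_pencil_of_injective isClosed_closure hdet hzc fun f hf => ?_
      by_contra hf0
      exact hzN ⟨hzb, IsReproducingKernelSubspace.quotientMem_of_pencil_eq_zero hU hD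
        (hne z hzc) hf0 hf⟩
  constructor
  · intro z hzb hacc
    have hzero : ∀ w ∈ poleSet H,
        rankOneDet (hH.evalCLM l) (l : ℝ) (projectedKernel D (l : ℝ) v) w = 0 ∧
          ¬ IsUnit (pencil D (l : ℝ) w) := by
      intro w hw
      have hwΩ := poleSet_subset hU hH hdiv hw
      obtain ⟨f, hf, hf0⟩ := IsReproducingKernelSubspace.exists_pencil_eq_zero_of_quotientMem hU hD
        hw.2 (hne w hwΩ)
      refine ⟨hB.rankOneDet_eq_zero_of_pencil_eq_zero hwΩ hf hf0, fun hu => hf ?_⟩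
      exact (ContinuousLinearMap.isUnit_iff_bijective.1 hu).1 (by rw [hf0, map_zero])
    rw [accPt_iff_frequently_nhdsNE] at hacc
    -- At a pole the zeros of the determinant are isolated; elsewhere off the boundary the pencil
    -- stays invertible nearby.
    by_cases hzN : z ∈ poleSet H
    · obtain ⟨w, hw, hw'⟩ := (hacc.and_eventually (hB.eventually_rankOneDet_ne_zero hdet
        (poleSet_subset hU hH hdiv hzN))).exists
      exact hw' (hzero w hw).1
    · obtain ⟨w, hw, hw'⟩ := (hacc.and_eventually
        (nhdsWithin_le_nhds (eventually_isUnit_pencil D _ (hunit z hzb hzN)))).exists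
      exact (hzero w hw).2 hw'
  · intro f hf
    obtain ⟨f, rfl⟩ := hH.exists_representative_eq hf
    refine ⟨resolventFunction D (hH.evalCLM l) (l : ℝ) f, ?_, ?_, ?_, ?_⟩
    · intro z hzb
      by_cases hzN : z ∈ poleSet H
      · exact hB.meromorphicAt_resolventFunction isClosed_closure hdet
          (poleSet_subset hU hH hdiv hzN) f
      · exact (analyticAt_resolventFunction D _ _ f (hunit z hzb hzN)).meromorphicAt
    · exact fun z hzb hzN => analyticAt_resolventFunction D _ _ f (hunit z hzb hzN)
    · exact fun x => analyticAt_resolventFunction D _ _ f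
        (IsReproducingKernelSubspace.isUnit_pencil_at hU hdiv hD x)
    · exact fun x => IsReproducingKernelSubspace.resolventFunction_at hU hdiv hD x f

/-- For H = 0 there is no v with v(l) = 1. The quotient condition at z could then hold only
vacuously, with U = {z}, but this z lies on the boundary. -/
theorem poleSet_eq_empty_of_eq_bot (hUne : U.Nonempty) (hH0 : ∀ f ∈ H, f = 0) :
    poleSet H = ∅ := by
  rw [Set.eq_empty_iff_forall_notMem]
  rintro z ⟨hzb, q, hq, hqx⟩
  obtain rfl := hH0 q hq
  have hUz : ∀ x : U, ((x : ℝ) : ℂ) = z := fun x => by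
    by_contra hx
    simpa using hqx x hx
  obtain ⟨a, ha⟩ := hUne
  have hUa : U = {a} := by
    ext x
    refine ⟨fun hx => ?_, fun hx => by rwa [Set.mem_singleton_iff.1 hx]⟩
    exact_mod_cast (hUz ⟨x, hx⟩).trans (hUz ⟨a, ha⟩).symm
  refine hzb ⟨a, ?_, hUz ⟨a, ha⟩⟩
  rw [hUa, frontier, closure_singleton, interior_singleton, Set.sdiff_empty]
  exact rfl

end Extension

end DivisionSubspace

theorem theorem3p1 (μ : Measure ℝ) [SigmaFinite μ] [NullSingletonClass μ]
    (U : Set ℝ) (hU : MeasurableSet U) (hUne : U.Nonempty) (hμU : μ Uᶜ = 0)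
    (H : Submodule ℂ (U → ℂ))
    (hH : DivisionSubspace.IsReproducingKernelSubspace μ U H)
    (hdiv : DivisionSubspace.StrongDivision H) :
    DivisionSubspace.poleSet H ⊆ (Complex.ofReal '' closure U)ᶜ ∧
    (∀ z : ℂ, z ∉ DivisionSubspace.realBoundary U →
      ¬ AccPt z (𝓟 (DivisionSubspace.poleSet H))) ∧
    ∀ f ∈ H, ∃ F : ℂ → ℂ,
      DivisionSubspace.IsMeromorphicExtension f (DivisionSubspace.poleSet H) F := by
  refine ⟨DivisionSubspace.poleSet_subset hU hH hdiv, ?_⟩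
  by_cases h0 : ∀ f ∈ H, f = 0
  · rw [DivisionSubspace.poleSet_eq_empty_of_eq_bot hUne h0]
    refine ⟨fun z _ => by simp [AccPt], fun f hf => ⟨0, ?_⟩⟩
    obtain rfl := h0 f hf
    exact ⟨fun z _ => analyticAt_const.meromorphicAt, fun z _ _ => analyticAt_const,
      fun x => analyticAt_const, fun x => rfl⟩
  · push Not at h0
    obtain ⟨g, hg, hg0⟩ := h0
    obtain ⟨l, hl⟩ := Function.ne_iff.1 hg0
    exact DivisionSubspace.discrete_and_extension_of_ne_zero hU hH hdiv hg hl
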